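/- Let $X$ and $U$ be Banach spaces (both real or both complex), let $A$ be the generator of a $C_0$-semigroup $(T(t))_{t\ge 0}$ on $X$, and let $\beta$ be a scalar in the resolvent set $\rho(A)$. Let $X_{-1}$ be the completion of $X$ with respect to the norm $\|x\|_{X_{-1}}=\|(\beta I-A)^{-1}x\|_X$, let $T_{-1}(t)$ denote the continuous extension of $T(t)$ to $X_{-1}$, let $B\in L(U,X_{-1})$, and let $\mathcal U:=L^\infty([0,\infty),U)$. Assume that $B$ is $\infty$-admissible, i.e. $\int_0^t T_{-1}(t-s)Bu(s)\,ds\in X$ for all $t\ge 0$ and $u\in\mathcal U$, and that for every $x_0\in X$ and $u\in\mathcal U$ the mild solution of $\dot x(t)=Ax(t)+Bu(t)$, $x(0)=x_0$, $$\phi(t,x_0,u):=T(t)x_0+\int_0^t T_{-1}(t-s)Bu(s)\,ds ,\qquad t\ge 0,$$ is continuous as a map $[0,\infty)\to X$. Let $\mathcal K$ be the set of continuous, strictly increasing $\gamma:[0,\infty)\to[0,\infty)$ with $\gamma(0)=0$, let $\mathcal K_\infty$ be the set of unbounded $\gamma\in\mathcal K$, and let $\mathcal{KL}$ be the set of $b:[0,\infty)^2\to[0,\infty)$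 such that $b(\cdot,t)\in\mathcal K$ for all $t\ge 0$ and, for all $r>0$, $b(r,\cdot)$ is continuous and strictly decreasing with limit $0$ at $\infty$. Then the following are equivalent: 1. The system is input-to-state stable (ISS): there are $b\in\mathcal{KL}$ and $\gamma\in\mathcal K$ such that $\|\phi(t,x,u)\|_X\le b(\|x\|_X,t)+\gamma(\|u\|_{\mathcal U})$ for all $x\in X$, $u\in\mathcal U$, $t\ge 0$. 2. The system is norm-to-integral ISS: there are $\alpha\in\mathcal K$ and $\psi,\sigma\in\mathcal K_\infty$ such that $\int_0^t\alpha(\|\phi(s,x,u)\|_X)\,ds\le\psi(\|x\|_X)+t\,\sigma(\|u\|_{\mathcal U})$ for all $x\in X$, $u\in\mathcal U$, $t\ge 0$. -/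

import Mathlib

open MeasureTheory Filter Topology Set
open scoped ENNReal

noncomputable section

namespace LinSys

/-! ### Comparison functions

A function on `[0, ∞)` is represented by a function on `ℝ` of which only the values on `[0, ∞)`
matter. -/

/-- Class `𝒦`: continuous and strictly increasing on `[0, ∞)`, with value `0` at `0`. -/
def ClassK (γ : ℝ → ℝ) : Prop :=
  ContinuousOn γ (Ici 0) ∧ StrictMonoOn γ (Ici 0) ∧ γ 0 = 0

/-- Class `𝒦_∞`: unbounded functions of class `𝒦`. -/
def ClassKInf (γ : ℝ → ℝ) : Prop :=
  ClassK γ ∧ ¬ BddAbove (γ '' Ici 0)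

/-- Class `ℒ`: continuous and strictly decreasing to `0` on `[0, ∞)` (hence positive there). -/
def ClassL (γ : ℝ → ℝ) : Prop :=
  ContinuousOn γ (Ici 0) ∧ StrictAntiOn γ (Ici 0) ∧ Tendsto γ atTop (𝓝 0)

/-- Class `𝒦ℒ`: of class `𝒦` in the first and of class `ℒ` in the second argument. -/
def ClassKL (β : ℝ → ℝ → ℝ) : Prop :=
  (∀ t, 0 ≤ t → ClassK fun r => β r t) ∧ ∀ r, 0 < r → ClassL fun t => β r t

/-! ### Stability notions for a transition map `φ (t, x, u)`, `t ≥ 0` -/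

section Stability

variable {X 𝒰 : Type*} [NormedAddCommGroup X] [NormedAddCommGroup 𝒰]

/-- (Uniform) input-to-state stability. -/
def IsISS (φ : ℝ → X → 𝒰 → X) : Prop :=
  ∃ β γ, ClassKL β ∧ ClassK γ ∧
    ∀ (x : X) (u : 𝒰) (t : ℝ), 0 ≤ t → ‖φ t x u‖ ≤ β ‖x‖ t + γ ‖u‖

/-- Norm-to-integral input-to-state stability. -/
def IsNormToIntegralISS (φ : ℝ → X → 𝒰 → X) : Prop :=
  ∃ α ψ σ, ClassK α ∧ ClassKInf ψ ∧ ClassKInf σ ∧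
    ∀ (x : X) (u : 𝒰) (t : ℝ), 0 ≤ t →
      ∫ s in (0 : ℝ)..t, α ‖φ s x u‖ ≤ ψ ‖x‖ + t * σ ‖u‖

end Stability

variable {𝕜 : Type*} [RCLike 𝕜]
variable {X : Type*} [NormedAddCommGroup X] [NormedSpace 𝕜 X]
variable {U : Type*} [NormedAddCommGroup U] [NormedSpace 𝕜 U]

/-! ### Semigroups and generators -/

/-- `(T t)_{t ≥ 0}` is a strongly continuous semigroup of bounded linear operators
(only the values `T t` with `t ≥ 0` matter). -/
structure IsC0Semigroup (T : ℝ → X →L[𝕜] X) : Prop where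
  zero : T 0 = ContinuousLinearMap.id 𝕜 X
  add : ∀ s t, 0 ≤ s → 0 ≤ t → T (s + t) = (T s).comp (T t)
  continuousOn : ∀ x, ContinuousOn (fun t => T t x) (Ici 0)

/-- `A` is the generator of `T`: `x ∈ D(A)` and `A x = y` if and only if
`(T h x - x) / h → y` as `h → 0+`. -/
def IsGenerator (A : X →ₗ.[𝕜] X) (T : ℝ → X →L[𝕜] X) : Prop :=
  ∀ x y : X, (x, y) ∈ A.graph ↔
    Tendsto (fun h : ℝ => ((h : 𝕜)⁻¹) • (T h x - x)) (𝓝[>] 0) (𝓝 y)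

/-- `R` is a bounded two-sided inverse of `β I - A : D(A) → X`. -/
def IsResolventAt (A : X →ₗ.[𝕜] X) (β : 𝕜) (R : X →L[𝕜] X) : Prop :=
  (∀ x : X, ∃ y : A.domain, (y : X) = R x ∧ β • (y : X) - A y = x) ∧
    ∀ y : A.domain, R (β • (y : X) - A y) = y

/-- The resolvent set `ρ(A)` of an unbounded operator. -/
def resolventSet (A : X →ₗ.[𝕜] X) : Set 𝕜 := {β | ∃ R, IsResolventAt A β R}

open Classical in
/-- The resolvent operator `(β I - A)⁻¹` for `β ∈ ρ(A)`. -/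
def resolvent (A : X →ₗ.[𝕜] X) (β : 𝕜) : X →L[𝕜] X :=
  if h : β ∈ resolventSet A then h.choose else 0

/-! ### The extrapolation space `X₋₁` -/

/-- The vector space `X`, to be endowed with the norm `‖(β I - A)⁻¹ x‖`. -/
def Renormed (_A : X →ₗ.[𝕜] X) (_β : 𝕜) : Type _ := X

instance (A : X →ₗ.[𝕜] X) (β : 𝕜) : AddCommGroup (Renormed A β) :=
  inferInstanceAs (AddCommGroup X)

instance (A : X →ₗ.[𝕜] X) (β : 𝕜) : Module 𝕜 (Renormed A β) :=
  inferInstanceAs (Module 𝕜 X)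

/-- The identity of `X`, regarded as a linear map into the renormed space. -/
def toRenormed (A : X →ₗ.[𝕜] X) (β : 𝕜) : X ≃ₗ[𝕜] Renormed A β := LinearEquiv.refl 𝕜 X

/-- `(β I - A)⁻¹` as a linear map from the renormed space to `X`. -/
def resolventRenormed (A : X →ₗ.[𝕜] X) (β : 𝕜) : Renormed A β →ₗ[𝕜] X :=
  (resolvent A β).toLinearMap ∘ₗ (toRenormed A β).symm.toLinearMap

instance (A : X →ₗ.[𝕜] X) (β : 𝕜) : SeminormedAddCommGroup (Renormed A β) :=
  SeminormedAddCommGroup.induced (Renormed A β) X (resolventRenormed A β)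

instance (A : X →ₗ.[𝕜] X) (β : 𝕜) : NormedSpace 𝕜 (Renormed A β) :=
  NormedSpace.induced 𝕜 (Renormed A β) X (resolventRenormed A β)

/-- The extrapolation space `X₋₁`: the completion of `X` with respect to
`‖x‖₋₁ = ‖(β I - A)⁻¹ x‖`. -/
def Extrap (A : X →ₗ.[𝕜] X) (β : 𝕜) : Type _ := UniformSpace.Completion (Renormed A β)

instance (A : X →ₗ.[𝕜] X) (β : 𝕜) : NormedAddCommGroup (Extrap A β) :=
  inferInstanceAs (NormedAddCommGroup (UniformSpace.Completion (Renormed A β)))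

instance (A : X →ₗ.[𝕜] X) (β : 𝕜) : NormedSpace 𝕜 (Extrap A β) :=
  inferInstanceAs (NormedSpace 𝕜 (UniformSpace.Completion (Renormed A β)))

instance (A : X →ₗ.[𝕜] X) (β : 𝕜) : CompleteSpace (Extrap A β) :=
  inferInstanceAs (CompleteSpace (UniformSpace.Completion (Renormed A β)))

/-- The real normed space structure on `X₋₁`, needed for the Bochner integral. -/
instance (A : X →ₗ.[𝕜] X) (β : 𝕜) : NormedSpace ℝ (Extrap A β) :=
  NormedSpace.restrictScalars ℝ 𝕜 (Extrap A β)

/-- The canonical embedding `X → X₋₁`. -/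
def emb (A : X →ₗ.[𝕜] X) (β : 𝕜) (x : X) : Extrap A β :=
  ((toRenormed A β x : Renormed A β) : UniformSpace.Completion (Renormed A β))

/-- The extension to `X₋₁` of a linear operator `S` on `X` that is bounded for `‖·‖₋₁`.
Applied to `T t` this is the extrapolated semigroup `T₋₁ t`; see `extend_emb`,
`uniformContinuous_extend`. -/
def extend (A : X →ₗ.[𝕜] X) (β : 𝕜) (S : X →L[𝕜] X) : Extrap A β → Extrap A β :=
  UniformSpace.Completion.map
    (fun x : Renormed A β => toRenormed A β (S ((toRenormed A β).symm x)))

/-! ### Mild solutions and admissibility -/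

/-- `∫₀ᵗ T₋₁(t - s) B u(s) ds`, a Bochner integral in `X₋₁`. -/
def inputIntegral (A : X →ₗ.[𝕜] X) (β : 𝕜) (T : ℝ → X →L[𝕜] X) (B : U →L[𝕜] Extrap A β)
    (t : ℝ) (u : ℝ → U) : Extrap A β :=
  ∫ s in (0 : ℝ)..t, extend A β (T (t - s)) (B (u s))

/-- The mild solution `T(t) x₀ + ∫₀ᵗ T₋₁(t - s) B u(s) ds` of `ẋ = A x + B u`, with values
in `X₋₁`. -/
def mildSolution (A : X →ₗ.[𝕜] X) (β : 𝕜) (T : ℝ → X →L[𝕜] X) (B : U →L[𝕜] Extrap A β)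
    (t : ℝ) (x₀ : X) (u : ℝ → U) : Extrap A β :=
  emb A β (T t x₀) + inputIntegral A β T B t u

/-- The input space `L^q([0, ∞), U)`. -/
abbrev InputSpace (U : Type*) [NormedAddCommGroup U] (q : ℝ≥0∞) : Type _ :=
  Lp U q (volume.restrict (Ici (0 : ℝ)))

/-- `B` is a `q`-admissible control operator: `∫₀ᵗ T₋₁(t - s) B u(s) ds ∈ X` for all `t ≥ 0`
and `u ∈ L^q([0, ∞), U)`. -/
def IsAdmissible (q : ℝ≥0∞) (A : X →ₗ.[𝕜] X) (β : 𝕜) (T : ℝ → X →L[𝕜] X)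
    (B : U →L[𝕜] Extrap A β) : Prop :=
  ∀ t : ℝ, 0 ≤ t → ∀ u : InputSpace U q, inputIntegral A β T B t u ∈ range (emb A β)

/-- The transition map `φ(t, x₀, u)`: the element of `X` that is the value at time `t` of the mild
solution (for `∞`-admissible `B` it exists, and it is unique by `emb_injective`). -/
def transitionMap (A : X →ₗ.[𝕜] X) (β : 𝕜) (T : ℝ → X →L[𝕜] X) (B : U →L[𝕜] Extrap A β)
    (t : ℝ) (x₀ : X) (u : InputSpace U ∞) : X :=
  Function.invFun (emb A β) (mildSolution A β T B t x₀ u)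

/-! ### The definitions above are meaningful -/

theorem resolvent_spec {A : X →ₗ.[𝕜] X} {β : 𝕜} (hβ : β ∈ resolventSet A) :
    IsResolventAt A β (resolvent A β) := by
  unfold resolvent
  rw [dif_pos hβ]
  exact hβ.choose_spec

theorem norm_emb (A : X →ₗ.[𝕜] X) (β : 𝕜) (x : X) : ‖emb A β x‖ = ‖resolvent A β x‖ :=
  UniformSpace.Completion.norm_coe (toRenormed A β x)

theorem emb_injective {A : X →ₗ.[𝕜] X} {β : 𝕜} (hβ : β ∈ resolventSet A) :
    Function.Injective (emb A β) := by
  intro x y h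
  have h1 : emb A β (x - y) = emb A β x - emb A β y :=
    UniformSpace.Completion.coe_sub (toRenormed A β x) (toRenormed A β y)
  have h2 : resolvent A β (x - y) = 0 := by
    rw [← norm_eq_zero, ← norm_emb, h1, h, sub_self, norm_zero]
  obtain ⟨z, hz, hz'⟩ := (resolvent_spec hβ).1 (x - y)
  have h3 : z = 0 := Subtype.ext (hz.trans h2)
  rw [h3] at hz'
  simp only [ZeroMemClass.coe_zero, smul_zero, LinearPMap.map_zero, sub_zero] at hz'
  exact sub_eq_zero.mp hz'.symm

/-- A `C₀`-semigroup commutes with the resolvent of its generator. -/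
theorem resolvent_comm {A : X →ₗ.[𝕜] X} {β : 𝕜} {T : ℝ → X →L[𝕜] X}
    (hT : IsC0Semigroup T) (hA : IsGenerator A T) (hβ : β ∈ resolventSet A)
    {t : ℝ} (ht : 0 ≤ t) (x : X) : resolvent A β (T t x) = T t (resolvent A β x) := by
  obtain ⟨y, hy, hx⟩ := (resolvent_spec hβ).1 x
  have h1 := (hA y (A y)).1 (A.mem_graph y)
  have h2 : (T t y, T t (A y)) ∈ A.graph := by
    refine (hA _ _).2 ((((T t).continuous.tendsto _).comp h1).congr' ?_)
    filter_upwards [self_mem_nhdsWithin] with h (hh : 0 < h)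
    have hc : T h (T t y) = T t (T h y) := by
      have e1 := hT.add h t hh.le ht
      have e2 := hT.add t h ht hh.le
      rw [add_comm, e1] at e2
      exact congrArg (fun S : X →L[𝕜] X => S (y : X)) e2
    simp [hc]
  obtain ⟨z, hz, hz'⟩ := (LinearPMap.mem_graph_iff A).1 h2
  have h3 := (resolvent_spec hβ).2 z
  simp only at hz hz'
  rw [hz, hz', ← map_smul, ← map_sub, hx, hy] at h3
  exact h3

/-- `T t` is bounded for `‖·‖₋₁`, so that it extends continuously to `X₋₁`. -/
theorem uniformContinuous_renormed {A : X →ₗ.[𝕜] X} {β : 𝕜} {T : ℝ → X →L[𝕜] X}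
    (hT : IsC0Semigroup T) (hA : IsGenerator A T) (hβ : β ∈ resolventSet A)
    {t : ℝ} (ht : 0 ≤ t) : UniformContinuous
      (fun x : Renormed A β => toRenormed A β (T t ((toRenormed A β).symm x))) := by
  let L : Renormed A β →ₗ[𝕜] Renormed A β :=
    (toRenormed A β).toLinearMap ∘ₗ (T t).toLinearMap ∘ₗ (toRenormed A β).symm.toLinearMap
  refine (AddMonoidHomClass.lipschitz_of_bound L ‖T t‖ fun x => ?_).uniformContinuous
  change ‖resolvent A β (T t ((toRenormed A β).symm x))‖ ≤
    ‖T t‖ * ‖resolvent A β ((toRenormed A β).symm x)‖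
  rw [resolvent_comm hT hA hβ ht]
  exact (T t).le_opNorm _

theorem extend_emb {A : X →ₗ.[𝕜] X} {β : 𝕜} {T : ℝ → X →L[𝕜] X}
    (hT : IsC0Semigroup T) (hA : IsGenerator A T) (hβ : β ∈ resolventSet A)
    {t : ℝ} (ht : 0 ≤ t) (x : X) : extend A β (T t) (emb A β x) = emb A β (T t x) :=
  UniformSpace.Completion.map_coe (uniformContinuous_renormed hT hA hβ ht) _

theorem uniformContinuous_extend (A : X →ₗ.[𝕜] X) (β : 𝕜) (S : X →L[𝕜] X) :
    UniformContinuous (extend A β S) :=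
  UniformSpace.Completion.uniformContinuous_map

end LinSys

end

/-! By linearity the transition map splits as `T t x + J t u`, where `J t` is the input-to-state
map. Putting `u = 0` or `x = 0` separates the two summands, and both properties reduce to the
existence of `τ > 0` with `‖T τ‖ ≤ 1 / 2`, which gives an exponential bound on `T`
(`exists_exp_bound`).

From ISS such a `τ` comes from the decay of `b 1`, and `‖J t u‖ ≤ γ ‖u‖`; integrating the
exponential bound plus this constant gives the integral estimate with `α` the identity.

From the integral estimate, `u = 0` leaves `∫ α ‖T s x‖ ≤ ψ ‖x‖`, and a Datko-type argument
(`exists_norm_le_half_of_integral_le`) yields `τ`. The input part needs no further use of the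
estimate: each `J t` is bounded into `X` by the closed graph theorem, continuity of trajectories and
Banach–Steinhaus make `J` bounded on `[0, τ]`, and the cocycle identity `J (t + h) u = T t (J h u) +
J t v`, with `v` a translate of `u`, carries this bound to all times because `T τ` halves the past
(`exists_bound_of_cocycle`). -/

namespace LinSys

/-! ### Norm bounds and exponential stability of semigroups -/

section Semigroup

variable {𝕜 : Type*} [RCLike 𝕜] {X : Type*} [NormedAddCommGroup X] [NormedSpace 𝕜 X]

/-- Comparison functions are not homogeneous, so they only control `S` on a fixed ball; linearity
turns this into an operator norm bound. -/
theorem opNorm_le_div_of_closedBall {Y : Type*} [NormedAddCommGroup Y] [NormedSpace 𝕜 Y]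
    (S : X →L[𝕜] Y) {ε c : ℝ} (hε : 0 < ε) (hc : 0 ≤ c)
    (h : ∀ x, ‖x‖ ≤ ε → ‖S x‖ ≤ c) : ‖S‖ ≤ c / ε := by
  refine S.opNorm_le_bound (by positivity) fun x => ?_
  rcases eq_or_ne x 0 with rfl | hx
  · simp
  have hx' : 0 < ‖x‖ := norm_pos_iff.2 hx
  have hn : ‖((ε / ‖x‖ : ℝ) : 𝕜)‖ = ε / ‖x‖ := by
    rw [RCLike.norm_ofReal, abs_of_pos (by positivity)]
  have h1 := h (((ε / ‖x‖ : ℝ) : 𝕜) • x) (by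
    rw [norm_smul, hn, div_mul_cancel₀ _ hx'.ne'])
  rw [map_smul, norm_smul, hn] at h1
  rw [div_mul_eq_mul_div, le_div_iff₀ hε]
  rw [div_mul_eq_mul_div, div_le_iff₀ hx'] at h1
  linarith

variable {T : ℝ → X →L[𝕜] X}

theorem IsC0Semigroup.apply_add (hT : IsC0Semigroup T) {s t : ℝ} (hs : 0 ≤ s) (ht : 0 ≤ t)
    (x : X) : T (s + t) x = T s (T t x) := by
  rw [hT.add s t hs ht]; rfl

theorem IsC0Semigroup.norm_add_le (hT : IsC0Semigroup T) {s t : ℝ} (hs : 0 ≤ s) (ht : 0 ≤ t) :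
    ‖T (s + t)‖ ≤ ‖T s‖ * ‖T t‖ := by
  rw [hT.add s t hs ht]; exact ContinuousLinearMap.opNorm_comp_le _ _

/-- Orbits are bounded on compact intervals, so uniform boundedness applies. It serves both the
semigroup and the input-to-state maps. -/
theorem exists_opNorm_le_of_continuousOn {E : Type*} [NormedAddCommGroup E] [NormedSpace 𝕜 E]
    [CompleteSpace E] {F : Type*} [NormedAddCommGroup F] [NormedSpace 𝕜 F]
    {S : ℝ → E →L[𝕜] F} (hS : ∀ x, ContinuousOn (fun t => S t x) (Ici 0)) (t₀ : ℝ) :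
    ∃ C, 1 ≤ C ∧ ∀ t ∈ Icc 0 t₀, ‖S t‖ ≤ C := by
  obtain ⟨C, hC⟩ := banach_steinhaus (g := fun t : Icc (0 : ℝ) t₀ => S t) fun x => by
    obtain ⟨C, hC⟩ := isCompact_Icc.exists_bound_of_continuousOn
      ((hS x).mono (Icc_subset_Ici_self : Icc 0 t₀ ⊆ Ici 0))
    exact ⟨C, fun t => hC t t.2⟩
  exact ⟨max 1 C, le_max_left _ _, fun t ht => (hC ⟨t, ht⟩).trans (le_max_right _ _)⟩

/-- Every time `t ≥ 0` is `n τ + r` with `r ∈ [0, τ]`. -/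
theorem exists_nat_mul_add {τ t : ℝ} (hτ : 0 < τ) (ht : 0 ≤ t) :
    ∃ (n : ℕ) (r : ℝ), r ∈ Icc 0 τ ∧ t = n * τ + r := by
  refine ⟨⌊t / τ⌋₊, t - ⌊t / τ⌋₊ * τ, ⟨?_, ?_⟩, by ring⟩
  · have := Nat.floor_le (div_nonneg ht hτ.le)
    rw [le_div_iff₀ hτ] at this
    linarith
  · have := (Nat.lt_floor_add_one (t / τ)).le
    rw [div_le_iff₀ hτ] at this
    linarith

/-- A semigroup with `‖T τ‖ ≤ 1 / 2` for some `τ > 0` is exponentially stable. -/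
theorem IsC0Semigroup.exists_exp_bound [CompleteSpace X] (hT : IsC0Semigroup T) {τ : ℝ}
    (hτ : 0 < τ) (h : ‖T τ‖ ≤ 1 / 2) :
    ∃ M l, 0 < M ∧ 0 < l ∧ ∀ t, 0 ≤ t → ‖T t‖ ≤ M * Real.exp (-(l * t)) := by
  obtain ⟨C, hC1, hC⟩ := exists_opNorm_le_of_continuousOn hT.continuousOn τ
  have hpow : ∀ (n : ℕ) (r : ℝ), r ∈ Icc 0 τ → ‖T (n * τ + r)‖ ≤ C * (1 / 2) ^ n := by
    intro n r hr
    induction n with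
    | zero => simpa using hC r hr
    | succ n ih =>
      have e : ((n + 1 : ℕ) : ℝ) * τ + r = τ + (n * τ + r) := by push_cast; ring
      rw [e, pow_succ]
      have hr0 := hr.1
      refine (hT.norm_add_le hτ.le (by positivity)).trans ?_
      calc ‖T τ‖ * ‖T (n * τ + r)‖ ≤ 1 / 2 * (C * (1 / 2) ^ n) := by gcongr
        _ = _ := by ring
  -- With this rate `(1 / 2) ^ n` is the exponential at time `n τ`; the remainder `r ≤ τ` costs at
  -- most the factor `2`.
  refine ⟨2 * C, Real.log 2 / τ, by linarith, div_pos (Real.log_pos one_lt_two) hτ,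
    fun t ht => ?_⟩
  obtain ⟨n, r, hr, rfl⟩ := exists_nat_mul_add hτ ht
  refine (hpow n r hr).trans ?_
  have e1 : (1 / 2 : ℝ) ^ n = Real.exp (-(Real.log 2 * n)) := by
    rw [Real.exp_neg, Real.exp_mul, Real.exp_log two_pos, Real.rpow_natCast, one_div, inv_pow]
  have e2 : (2 : ℝ) * Real.exp (-(Real.log 2 / τ * (n * τ + r)))
      = Real.exp (Real.log 2 - (Real.log 2 / τ * (n * τ + r))) := by
    rw [sub_eq_add_neg, Real.exp_add, Real.exp_log two_pos]
  rw [mul_comm 2 C, mul_assoc, e2, e1]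
  gcongr
  have h2 : Real.log 2 / τ * (n * τ + r) = Real.log 2 * n + Real.log 2 * (r / τ) := by
    field_simp
  have h3 : r / τ ≤ 1 := (div_le_one hτ).2 hr.2
  have h4 := Real.log_pos one_lt_two
  rw [h2]
  nlinarith

/-! ### Comparison functions and the Datko-type argument -/

theorem ClassK.pos {γ : ℝ → ℝ} (hγ : ClassK γ) {r : ℝ} (hr : 0 < r) : 0 < γ r := by
  have := hγ.2.1 (mem_Ici.2 le_rfl) (mem_Ici.2 hr.le) hr
  rwa [hγ.2.2] at this

theorem ClassK.mono {γ : ℝ → ℝ} (hγ : ClassK γ) {r s : ℝ} (hr : 0 ≤ r) (h : r ≤ s) :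
    γ r ≤ γ s :=
  hγ.2.1.monotoneOn (mem_Ici.2 hr) (mem_Ici.2 (hr.trans h)) h

theorem ClassK.nonneg {γ : ℝ → ℝ} (hγ : ClassK γ) {r : ℝ} (hr : 0 ≤ r) : 0 ≤ γ r := by
  have := hγ.mono le_rfl hr
  rwa [hγ.2.2] at this

theorem ClassK.lt_of_lt {γ : ℝ → ℝ} (hγ : ClassK γ) {r s : ℝ} (hs : 0 ≤ s) (h : γ r < γ s) :
    r < s := by
  by_contra! hc
  exact (hγ.mono hs hc).not_gt h

theorem ClassK.exists_lt {γ : ℝ → ℝ} (hγ : ClassK γ) {c : ℝ} (hc : 0 < c) :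
    ∃ ε, 0 < ε ∧ γ ε < c := by
  have h := (hγ.1 0 (mem_Ici.2 le_rfl)).mono (Ioi_subset_Ici_self)
  have h' : Tendsto γ (𝓝[>] 0) (𝓝 0) := by simpa [ContinuousWithinAt, hγ.2.2] using h
  obtain ⟨ε, h1, h2⟩ := ((h'.eventually (gt_mem_nhds hc)).and self_mem_nhdsWithin).exists
  exact ⟨ε, h2, h1⟩

theorem ClassK.intervalIntegrable_comp_norm {α : ℝ → ℝ} (hα : ClassK α) {f : ℝ → X}
    (hf : ContinuousOn f (Ici 0)) {a b : ℝ} (ha : 0 ≤ a) (hb : 0 ≤ b) :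
    IntervalIntegrable (fun s => α ‖f s‖) volume a b := by
  refine ((hα.1.comp hf.norm fun s _ => norm_nonneg (f s)).mono ?_).intervalIntegrable
  exact fun s hs => (le_inf ha hb).trans hs.1

/-- If `K ‖f s‖ ≥ c` on `[a, b]`, then the integral of `α ‖f s‖` over `[0, b]` is bounded below. -/
theorem ClassK.mul_le_integral {α : ℝ → ℝ} (hα : ClassK α) {f : ℝ → X}
    (hf : ContinuousOn f (Ici 0)) {a b c : ℝ} (ha : 0 ≤ a) (hab : a ≤ b) (hc : 0 ≤ c)
    (h : ∀ s ∈ Icc a b, c ≤ ‖f s‖) :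
    (b - a) * α c ≤ ∫ s in (0 : ℝ)..b, α ‖f s‖ := by
  have hb := ha.trans hab
  have h1 := intervalIntegral.integral_mono_on hab (intervalIntegrable_const (c := α c))
    (hα.intervalIntegrable_comp_norm hf ha hb) fun s hs => hα.mono hc (h s hs)
  have h2 : 0 ≤ ∫ s in (0 : ℝ)..a, α ‖f s‖ :=
    intervalIntegral.integral_nonneg ha fun s _ => hα.nonneg (norm_nonneg _)
  rw [intervalIntegral.integral_const, smul_eq_mul] at h1
  rw [← intervalIntegral.integral_add_adjacent_intervals
    (hα.intervalIntegrable_comp_norm hf le_rfl ha) (hα.intervalIntegrable_comp_norm hf ha hb)]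
  linarith

/-- A Datko-type theorem: a semigroup whose orbits satisfy `∫₀^∞ α ‖T s x‖ ds ≤ ψ ‖x‖` is
eventually contractive. -/
theorem IsC0Semigroup.exists_norm_le_half_of_integral_le [CompleteSpace X] (hT : IsC0Semigroup T)
    {α ψ : ℝ → ℝ} (hα : ClassK α) (hψ : ClassK ψ)
    (h : ∀ x t, 0 ≤ t → ∫ s in (0 : ℝ)..t, α ‖T s x‖ ≤ ψ ‖x‖) :
    ∃ τ, 0 < τ ∧ ‖T τ‖ ≤ 1 / 2 := by
  obtain ⟨M, hM1, hM⟩ := exists_opNorm_le_of_continuousOn hT.continuousOn 1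
  have hM0 : 0 < M := by linarith
  obtain ⟨ε, hε, hψε⟩ := hψ.exists_lt (hα.pos one_pos)
  -- A large value at time `t` forces large values earlier, since `T t x = T (t - s) (T s x)`.
  have back : ∀ {N s t : ℝ} {x : X}, 0 < N → 0 ≤ s → s ≤ t → ‖T (t - s)‖ ≤ N →
      ‖T t x‖ / N ≤ ‖T s x‖ := by
    intro N s t x hN hs hst hb
    rw [div_le_iff₀ hN]
    have e := hT.apply_add (sub_nonneg.2 hst) hs x
    rw [sub_add_cancel] at e
    rw [e, mul_comm]
    exact ContinuousLinearMap.le_of_opNorm_le _ hb _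
  -- Uniform boundedness: over the window `[t - 1, t]` the integral is at least `α (‖T t x‖ / M)`,
  -- while for `‖x‖ ≤ ε` it is at most `ψ ε < α 1`.
  have hN : ∀ t, 0 ≤ t → ‖T t‖ ≤ max M (M / ε) := by
    intro t ht
    rcases le_total t 1 with h1 | h1
    · exact (hM t ⟨ht, h1⟩).trans (le_max_left _ _)
    refine le_trans (opNorm_le_div_of_closedBall (T t) hε hM0.le fun x hx => ?_) (le_max_right _ _)
    have h2 := hα.mul_le_integral (hT.continuousOn x) (sub_nonneg.2 h1) (sub_le_self t zero_le_one)
      (div_nonneg (norm_nonneg (T t x)) hM0.le) fun s hs =>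
        back hM0 ((sub_nonneg.2 h1).trans hs.1) hs.2
          (hM _ ⟨sub_nonneg.2 hs.2, by linarith [hs.1]⟩)
    have h3 : α (‖T t x‖ / M) < α 1 := by
      have := h x t ht
      have := hψ.mono (norm_nonneg x) hx
      linarith
    exact ((div_lt_one hM0).1 (hα.lt_of_lt zero_le_one h3)).le
  set N := max M (M / ε)
  have hN0 : 0 < N := hM0.trans_le (le_max_left _ _)
  have hc : 0 < 1 / 2 / N := by positivity
  have hαc := hα.pos hc
  have hψ1 := hψ.pos one_pos
  -- Now the window is all of `[0, t]`, and `t` is chosen so that `t * α (1 / 2 / N)` exceeds `ψ 1`.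
  set t := ψ 1 / α (1 / 2 / N) + 1
  have ht : 0 < t := by positivity
  refine ⟨t, ht, ?_⟩
  have := opNorm_le_div_of_closedBall (T t) (c := 1 / 2) one_pos (by norm_num) fun x hx => ?_
  · simpa using this
  have h2 := hα.mul_le_integral (hT.continuousOn x) le_rfl ht.le
    (div_nonneg (norm_nonneg (T t x)) hN0.le) fun s hs =>
      back hN0 hs.1 hs.2 (hN _ (sub_nonneg.2 hs.2))
  have h3 : t * α (‖T t x‖ / N) < t * α (1 / 2 / N) := by
    have h4 := h x t ht.le
    have h5 := hψ.mono (norm_nonneg x) hx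
    have h6 : t * α (1 / 2 / N) = ψ 1 + α (1 / 2 / N) := by
      simp only [t]; rw [add_mul, one_mul, div_mul_cancel₀ _ hαc.ne']
    linarith
  have h7 := hα.lt_of_lt hc.le (lt_of_mul_lt_mul_left h3 ht.le)
  exact ((div_lt_div_iff_of_pos_right hN0).1 h7).le

end Semigroup

end LinSys

namespace LinSys

/-! ### The extrapolated semigroup -/

section Extrapolation

variable {𝕜 : Type*} [RCLike 𝕜] {X : Type*} [NormedAddCommGroup X] [NormedSpace 𝕜 X]
  {U : Type*} [NormedAddCommGroup U] [NormedSpace 𝕜 U]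

/-- The canonical embedding `X → X₋₁` as a continuous linear map. -/
noncomputable def embCLM (A : X →ₗ.[𝕜] X) (β : 𝕜) : X →L[𝕜] Extrap A β :=
  LinearMap.mkContinuous
    { toFun := emb A β
      map_add' := fun x y =>
        UniformSpace.Completion.coe_add (toRenormed A β x) (toRenormed A β y)
      map_smul' := fun c x =>
        UniformSpace.Completion.coe_smul c (toRenormed A β x) }
    ‖resolvent A β‖ fun x => (norm_emb A β x).trans_le ((resolvent A β).le_opNorm x)

@[simp] theorem embCLM_apply (A : X →ₗ.[𝕜] X) (β : 𝕜) (x : X) : embCLM A β x = emb A β x := rfl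

theorem denseRange_emb (A : X →ₗ.[𝕜] X) (β : 𝕜) : DenseRange (emb A β) :=
  UniformSpace.Completion.denseRange_coe.comp (toRenormed A β).surjective.denseRange
    (UniformSpace.Completion.continuous_coe _)

variable {A : X →ₗ.[𝕜] X} {β : 𝕜} {T : ℝ → X →L[𝕜] X}

theorem emb_add (A : X →ₗ.[𝕜] X) (β : 𝕜) (x y : X) : emb A β (x + y) = emb A β x + emb A β y :=
  (embCLM A β).map_add x y

theorem emb_smul (A : X →ₗ.[𝕜] X) (β : 𝕜) (c : 𝕜) (x : X) : emb A β (c • x) = c • emb A β x :=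
  (embCLM A β).map_smul c x

theorem continuous_extend (A : X →ₗ.[𝕜] X) (β : 𝕜) (S : X →L[𝕜] X) :
    Continuous (extend A β S) :=
  (uniformContinuous_extend A β S).continuous

/-- The extrapolated semigroup, as a family of continuous linear maps. -/
noncomputable def extendCLM (hT : IsC0Semigroup T) (hA : IsGenerator A T) (hβ : β ∈ resolventSet A)
    {t : ℝ} (ht : 0 ≤ t) : Extrap A β →L[𝕜] Extrap A β :=
  LinearMap.mkContinuous
    { toFun := extend A β (T t)
      map_add' := fun x y => by
        have hc := continuous_extend A β (T t)
        refine (denseRange_emb A β).induction_on₂ (p := fun x y =>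
          extend A β (T t) (x + y) = extend A β (T t) x + extend A β (T t) y) ?_ ?_ x y
        · exact isClosed_eq (hc.comp continuous_add)
            ((hc.comp continuous_fst).add (hc.comp continuous_snd))
        · intro a b
          rw [← emb_add, extend_emb hT hA hβ ht, extend_emb hT hA hβ ht, extend_emb hT hA hβ ht,
            map_add, emb_add]
      map_smul' := fun c x => by
        have hc := continuous_extend A β (T t)
        refine (denseRange_emb A β).induction_on (p := fun x =>
          extend A β (T t) (c • x) = c • extend A β (T t) x) x ?_ ?_
        · exact isClosed_eq (hc.comp (continuous_const_smul c)) (hc.const_smul c)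
        · intro a
          rw [← emb_smul, extend_emb hT hA hβ ht, extend_emb hT hA hβ ht, map_smul, emb_smul] }
    ‖T t‖ fun x => by
      have hc := continuous_extend A β (T t)
      refine (denseRange_emb A β).induction_on
        (p := fun x => ‖extend A β (T t) x‖ ≤ ‖T t‖ * ‖x‖) x ?_ ?_
      · exact isClosed_le hc.norm (continuous_norm.const_mul _)
      · intro a
        -- The resolvent commutes with `T t`, so on the dense image of `X` the operator norm does
        -- not grow.
        rw [extend_emb hT hA hβ ht, norm_emb, norm_emb, resolvent_comm hT hA hβ ht]
        exact (T t).le_opNorm _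

@[simp] theorem extendCLM_apply (hT : IsC0Semigroup T) (hA : IsGenerator A T)
    (hβ : β ∈ resolventSet A) {t : ℝ} (ht : 0 ≤ t) (x : Extrap A β) :
    extendCLM hT hA hβ ht x = extend A β (T t) x := rfl

theorem norm_extend_le (hT : IsC0Semigroup T) (hA : IsGenerator A T) (hβ : β ∈ resolventSet A)
    {t : ℝ} (ht : 0 ≤ t) (x : Extrap A β) : ‖extend A β (T t) x‖ ≤ ‖T t‖ * ‖x‖ :=
  (extendCLM hT hA hβ ht).le_of_opNorm_le (LinearMap.mkContinuous_norm_le _ (norm_nonneg _) _) x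

theorem extend_add (hT : IsC0Semigroup T) (hA : IsGenerator A T) (hβ : β ∈ resolventSet A)
    {s t : ℝ} (hs : 0 ≤ s) (ht : 0 ≤ t) (x : Extrap A β) :
    extend A β (T (s + t)) x = extend A β (T s) (extend A β (T t) x) := by
  refine (denseRange_emb A β).induction_on x (isClosed_eq ?_ ?_) fun a => ?_
  · exact continuous_extend A β _
  · exact (continuous_extend A β _).comp (continuous_extend A β _)
  · rw [extend_emb hT hA hβ ht, extend_emb hT hA hβ hs, extend_emb hT hA hβ (add_nonneg hs ht),
      hT.apply_add hs ht]

/-- Joint continuity of the extrapolated semigroup. -/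
theorem continuousOn_extend [CompleteSpace X] (hT : IsC0Semigroup T) (hA : IsGenerator A T)
    (hβ : β ∈ resolventSet A) :
    ContinuousOn (fun p : ℝ × Extrap A β => extend A β (T p.1) p.2) (Ici 0 ×ˢ univ) := by
  rintro ⟨t, y⟩ ⟨ht : 0 ≤ t, -⟩
  obtain ⟨C, hC1, hC⟩ := exists_opNorm_le_of_continuousOn hT.continuousOn (t + 1)
  rw [Metric.continuousWithinAt_iff]
  intro ε hε
  have hC0 : 0 < C := by linarith
  -- Approximate `y` by a vector of `X`, whose orbit is continuous; the local bound `C` controls the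
  -- other three of four errors of size `ε / 4`.
  obtain ⟨a, ha⟩ := (denseRange_emb A β).exists_dist_lt y (ε := ε / (4 * C)) (by positivity)
  obtain ⟨δ, hδ, hδ'⟩ := Metric.continuousOn_iff.1
    ((embCLM A β).continuous.comp_continuousOn (hT.continuousOn a)) t ht (ε / 4) (by positivity)
  refine ⟨min (min δ 1) (ε / (4 * C)), by positivity, ?_⟩
  rintro ⟨s, z⟩ ⟨hs : 0 ≤ s, -⟩ hd
  rw [Prod.dist_eq, max_lt_iff] at hd
  obtain ⟨hd1, hd2⟩ := hd
  simp only [lt_min_iff] at hd1 hd2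
  have hst : s ≤ t + 1 := by
    have := (abs_lt.1 (Real.dist_eq s t ▸ hd1.1.2)).2
    linarith
  have key : ∀ r, 0 ≤ r → r ≤ t + 1 → ∀ p q : Extrap A β, dist p q < ε / (4 * C) →
      dist (extend A β (T r) p) (extend A β (T r) q) < ε / 4 := by
    intro r hr hr' p q hpq
    have e := (extendCLM hT hA hβ hr).map_sub p q
    simp only [extendCLM_apply] at e
    rw [dist_eq_norm] at hpq ⊢
    rw [← e]
    calc _ ≤ ‖T r‖ * ‖p - q‖ := norm_extend_le hT hA hβ hr _
      _ ≤ C * ‖p - q‖ := by gcongr; exact hC r ⟨hr, hr'⟩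
      _ < C * (ε / (4 * C)) := by gcongr
      _ = ε / 4 := by field_simp
  have h1 := key s hs hst z y hd2.2
  have h2 := key s hs hst y _ ha
  have h3 := key t ht (by linarith) y _ ha
  have h4 := hδ' s hs hd1.1.1
  simp only [Function.comp, embCLM_apply, ← extend_emb hT hA hβ hs,
    ← extend_emb hT hA hβ ht] at h4
  rw [dist_comm] at h3
  have := dist_triangle4 (extend A β (T s) z) (extend A β (T s) y) (extend A β (T s) (emb A β a))
    (extend A β (T t) y)
  have := dist_triangle (extend A β (T s) (emb A β a)) (extend A β (T t) (emb A β a))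
    (extend A β (T t) y)
  simp only
  linarith

/-! ### The input integral as a bounded operator -/

theorem ae_norm_le_norm_inputSpace (u : InputSpace U ∞) :
    ∀ᵐ s ∂volume.restrict (Ici (0 : ℝ)), ‖u s‖ ≤ ‖u‖ := by
  filter_upwards [ae_le_eLpNormEssSup (f := u) (μ := volume.restrict (Ici (0 : ℝ)))] with s hs
  have hfin := (Lp.memLp u).2.ne
  rw [Lp.norm_def, ← toReal_enorm]
  rw [eLpNorm_exponent_top] at hfin ⊢
  exact ENNReal.toReal_mono hfin hs

theorem ae_mem_uIoc_of_ae_Ici {p : ℝ → Prop} {a b : ℝ} (ha : 0 ≤ a) (hb : 0 ≤ b)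
    (h : ∀ᵐ s ∂volume.restrict (Ici (0 : ℝ)), p s) : ∀ᵐ s, s ∈ uIoc a b → p s := by
  rw [ae_restrict_iff' measurableSet_Ici] at h
  filter_upwards [h] with s hs hm
  exact hs ((le_inf ha hb).trans hm.1.le)

theorem aestronglyMeasurable_extend [CompleteSpace X] (hT : IsC0Semigroup T)
    (hA : IsGenerator A T) (hβ : β ∈ resolventSet A) (B : U →L[𝕜] Extrap A β) {t : ℝ}
    (u : InputSpace U ∞) :
    AEStronglyMeasurable (fun s => extend A β (T (t - s)) (B (u s)))
      (volume.restrict (Icc 0 t)) := by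
  -- Nothing is known about `T` at negative times; clamping gives a globally continuous map that
  -- agrees with the original for `s ≤ t`.
  have hc : Continuous fun p : ℝ × Extrap A β => extend A β (T (max p.1 0)) p.2 :=
    (continuousOn_extend hT hA hβ).comp_continuous (f := fun p : ℝ × Extrap A β => (max p.1 0, p.2))
      (by fun_prop) fun p => ⟨le_max_right p.1 0, mem_univ _⟩
  have hu : AEStronglyMeasurable u (volume.restrict (Icc 0 t)) :=
    (Lp.aestronglyMeasurable u).mono_measure (Measure.restrict_mono Icc_subset_Ici_self le_rfl)
  have h := hc.comp_aestronglyMeasurable (AEStronglyMeasurable.prodMk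
    (f := fun s : ℝ => t - s) (by fun_prop : Continuous fun s : ℝ => t - s).aestronglyMeasurable
    (B.continuous.comp_aestronglyMeasurable hu))
  refine h.congr ?_
  filter_upwards [ae_restrict_mem measurableSet_Icc] with s hs
  simp [max_eq_left (sub_nonneg.2 hs.2)]

theorem ae_norm_extend_le (hT : IsC0Semigroup T) (hA : IsGenerator A T)
    (hβ : β ∈ resolventSet A) (B : U →L[𝕜] Extrap A β) {t C : ℝ} (ht : 0 ≤ t)
    (hC : ∀ s ∈ Icc 0 t, ‖T s‖ ≤ C) (u : InputSpace U ∞) :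
    ∀ᵐ s, s ∈ uIoc 0 t → ‖extend A β (T (t - s)) (B (u s))‖ ≤ C * (‖B‖ * ‖u‖) := by
  filter_upwards [ae_mem_uIoc_of_ae_Ici le_rfl ht (ae_norm_le_norm_inputSpace u)] with s hs hm
  have hs' := hs hm
  rw [uIoc_of_le ht] at hm
  have hts : 0 ≤ t - s := sub_nonneg.2 hm.2
  have h1 := hC _ ⟨hts, by linarith [hm.1]⟩
  have hC0 : 0 ≤ C := (norm_nonneg _).trans h1
  refine (norm_extend_le hT hA hβ hts _).trans ?_
  have := B.le_of_opNorm_le le_rfl (u s)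
  gcongr
  exact this.trans (by gcongr)

theorem intervalIntegrable_extend [CompleteSpace X] (hT : IsC0Semigroup T)
    (hA : IsGenerator A T) (hβ : β ∈ resolventSet A) (B : U →L[𝕜] Extrap A β) {t : ℝ} (ht : 0 ≤ t)
    (u : InputSpace U ∞) :
    IntervalIntegrable (fun s => extend A β (T (t - s)) (B (u s))) volume 0 t := by
  obtain ⟨C, -, hC⟩ := exists_opNorm_le_of_continuousOn hT.continuousOn t
  have h := ae_norm_extend_le hT hA hβ B ht hC u
  have hm := (aestronglyMeasurable_extend hT hA hβ B (t := t) u).mono_measure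
    (Measure.restrict_mono Ioc_subset_Icc_self le_rfl)
  rw [intervalIntegrable_iff, uIoc_of_le ht]
  rw [uIoc_of_le ht, ← ae_restrict_iff' measurableSet_Ioc] at h
  exact ⟨hm, HasFiniteIntegral.restrict_of_bounded _ (by simp) h⟩

/-- The input-to-state map `u ↦ ∫₀ᵗ T₋₁(t - s) B u(s) ds` as a continuous linear map into `X₋₁`. -/
theorem exists_clm_inputIntegral [CompleteSpace X] (hT : IsC0Semigroup T) (hA : IsGenerator A T)
    (hβ : β ∈ resolventSet A) (B : U →L[𝕜] Extrap A β) {t : ℝ} (ht : 0 ≤ t) :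
    ∃ Φ : InputSpace U ∞ →L[𝕜] Extrap A β, ∀ u, Φ u = inputIntegral A β T B t u := by
  obtain ⟨C, hC1, hC⟩ := exists_opNorm_le_of_continuousOn hT.continuousOn t
  have hadd : ∀ u v : InputSpace U ∞, inputIntegral A β T B t ⇑(u + v)
      = inputIntegral A β T B t u + inputIntegral A β T B t v := by
    intro u v
    unfold inputIntegral
    rw [← intervalIntegral.integral_add (intervalIntegrable_extend hT hA hβ B ht u)
      (intervalIntegrable_extend hT hA hβ B ht v)]
    refine intervalIntegral.integral_congr_ae ?_
    filter_upwards [ae_mem_uIoc_of_ae_Ici le_rfl ht (Lp.coeFn_add u v)] with s hs hm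
    rw [hs hm]
    rw [uIoc_of_le ht] at hm
    simp only [← extendCLM_apply hT hA hβ (sub_nonneg.2 hm.2), Pi.add_apply, map_add]
  have hsmul : ∀ (c : 𝕜) (u : InputSpace U ∞), inputIntegral A β T B t ⇑(c • u)
      = c • inputIntegral A β T B t u := by
    intro c u
    have hc : ∀ x, (c • ContinuousLinearMap.id 𝕜 (Extrap A β)) x = c • x := fun x => rfl
    unfold inputIntegral
    rw [← hc]
    rw [← ContinuousLinearMap.intervalIntegral_comp_comm _
      (intervalIntegrable_extend hT hA hβ B ht u)]
    refine intervalIntegral.integral_congr_ae ?_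
    filter_upwards [ae_mem_uIoc_of_ae_Ici le_rfl ht (Lp.coeFn_smul c u)] with s hs hm
    rw [hs hm]
    rw [uIoc_of_le ht] at hm
    simp only [← extendCLM_apply hT hA hβ (sub_nonneg.2 hm.2), Pi.smul_apply, map_smul]
    rfl
  refine ⟨LinearMap.mkContinuous { toFun := fun u => inputIntegral A β T B t u
                                   map_add' := hadd
                                   map_smul' := hsmul } (C * ‖B‖ * t) fun u => ?_, fun u => rfl⟩
  have := intervalIntegral.norm_integral_le_of_norm_le_const_ae
    (ae_norm_extend_le hT hA hβ B ht hC u)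
  rw [sub_zero, abs_of_nonneg ht] at this
  exact this.trans_eq (by ring)

/-- For an admissible control operator the input-to-state map is bounded with values in `X`
(closed graph theorem). -/
theorem IsAdmissible.exists_clm [CompleteSpace X] (hT : IsC0Semigroup T) (hA : IsGenerator A T)
    (hβ : β ∈ resolventSet A) {B : U →L[𝕜] Extrap A β} (hB : IsAdmissible ∞ A β T B)
    [CompleteSpace U] {t : ℝ} (ht : 0 ≤ t) :
    ∃ Ψ : InputSpace U ∞ →L[𝕜] X, ∀ u, emb A β (Ψ u) = inputIntegral A β T B t u := by
  obtain ⟨Φ, hΦ⟩ := exists_clm_inputIntegral hT hA hβ B ht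
  choose g hg using hB t ht
  have hinj := emb_injective hβ
  let G : InputSpace U ∞ →ₗ[𝕜] X :=
    { toFun := g
      map_add' := fun u v => hinj (by simp only [emb_add, hg, ← hΦ, map_add])
      map_smul' := fun c u => hinj (by simp only [emb_smul, hg, ← hΦ, map_smul, RingHom.id_apply]) }
  have hG : ∀ u, emb A β (G u) = Φ u := fun u => (hg u).trans (hΦ u).symm
  refine ⟨⟨G, G.continuous_of_isClosed_graph ?_⟩, hg⟩
  -- Since the embedding is injective, the graph is the equality set of two maps continuous into
  -- `X₋₁`, hence closed.
  have : (G.graph : Set (InputSpace U ∞ × X)) = {p | embCLM A β p.2 = Φ p.1} := by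
    ext p
    simp only [SetLike.mem_coe, LinearMap.mem_graph_iff, mem_ofPred_eq, embCLM_apply, ← hG]
    exact hinj.eq_iff.symm
  rw [this]
  exact isClosed_eq (by fun_prop) (by fun_prop)

/-! ### Translated inputs and the cocycle identity -/

/-- The left translation of an essentially bounded input. -/
theorem exists_shift {h : ℝ} (hh : 0 ≤ h) (u : InputSpace U ∞) :
    ∃ v : InputSpace U ∞, ‖v‖ ≤ ‖u‖ ∧
      ∀ᵐ s ∂volume.restrict (Ici (0 : ℝ)), v s = u (s + h) := by
  have hmeas : Measurable fun s : ℝ => s + h := by fun_prop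
  -- The image measure is Lebesgue measure on `[h, ∞)`, so translation respects a.e. classes and
  -- does not increase the norm.
  have hmap : Measure.map (fun s : ℝ => s + h) (volume.restrict (Ici 0))
      ≤ volume.restrict (Ici 0) := by
    have e : Ici (0 : ℝ) = (fun s : ℝ => s + h) ⁻¹' Ici h := by ext s; simp
    conv_lhs => rw [e]
    rw [← Measure.restrict_map hmeas measurableSet_Ici, map_add_right_eq_self]
    exact Measure.restrict_mono (Ici_subset_Ici.2 hh) le_rfl
  have hu := (Lp.memLp u).mono_measure hmap
  have hv := hu.comp_of_map hmeas.aemeasurable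
  refine ⟨hv.toLp _, ?_, hv.coeFn_toLp⟩
  rw [Lp.norm_toLp, Lp.norm_def, ← eLpNorm_map_measure hu.1 hmeas.aemeasurable]
  exact ENNReal.toReal_mono (Lp.memLp u).2.ne (eLpNorm_mono_measure _ hmap)

/-- Split the integral at `h`: on `[0, h]` the semigroup law pulls out the extension of `T t`, and
on `[h, t + h]` a substitution produces the translated input. -/
theorem inputIntegral_add [CompleteSpace X] (hT : IsC0Semigroup T) (hA : IsGenerator A T)
    (hβ : β ∈ resolventSet A) (B : U →L[𝕜] Extrap A β) {t h : ℝ} (ht : 0 ≤ t) (hh : 0 ≤ h)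
    {u v : InputSpace U ∞} (hv : ∀ᵐ s ∂volume.restrict (Ici (0 : ℝ)), v s = u (s + h)) :
    inputIntegral A β T B (t + h) u
      = extend A β (T t) (inputIntegral A β T B h u) + inputIntegral A β T B t v := by
  have hi := intervalIntegrable_extend hT hA hβ B (add_nonneg ht hh) u
  have e1 : ∫ s in (0 : ℝ)..h, extend A β (T (t + h - s)) (B (u s))
      = extend A β (T t) (inputIntegral A β T B h u) := by
    unfold inputIntegral
    rw [← extendCLM_apply hT hA hβ ht, ← ContinuousLinearMap.intervalIntegral_comp_comm _
      (intervalIntegrable_extend hT hA hβ B hh u)]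
    refine intervalIntegral.integral_congr fun s hs => ?_
    rw [uIcc_of_le hh] at hs
    simp only [extendCLM_apply]
    rw [← extend_add hT hA hβ ht (sub_nonneg.2 hs.2), add_sub_assoc]
  have e2 : ∫ s in h..(t + h), extend A β (T (t + h - s)) (B (u s))
      = inputIntegral A β T B t v := by
    have := intervalIntegral.integral_comp_add_right (a := 0) (b := t)
      (fun s => extend A β (T (t + h - s)) (B (u s))) h
    rw [zero_add] at this
    rw [← this]
    refine intervalIntegral.integral_congr_ae ?_
    filter_upwards [ae_mem_uIoc_of_ae_Ici le_rfl ht hv] with s hs hm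
    rw [hs hm, add_sub_add_right_eq_sub]
  have hsub : uIcc 0 h ⊆ uIcc 0 (t + h) ∧ uIcc h (t + h) ⊆ uIcc 0 (t + h) := by
    rw [uIcc_of_le hh, uIcc_of_le (add_nonneg ht hh), uIcc_of_le (by linarith)]
    exact ⟨Icc_subset_Icc_right (by linarith), Icc_subset_Icc_left hh⟩
  rw [← e1, ← e2, intervalIntegral.integral_add_adjacent_intervals (hi.mono_set hsub.1)
    (hi.mono_set hsub.2)]
  rfl

end Extrapolation

end LinSys

namespace LinSys

/-! ### Comparison-function witnesses and uniform bounds on the inputs -/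

section Equivalence

variable {𝕜 : Type*} [RCLike 𝕜] {X : Type*} [NormedAddCommGroup X] [NormedSpace 𝕜 X]
  {U : Type*} [NormedAddCommGroup U] [NormedSpace 𝕜 U]

theorem classK_const_mul {c : ℝ} (hc : 0 < c) : ClassK fun r => c * r :=
  ⟨by fun_prop, fun _ _ _ _ h => mul_lt_mul_of_pos_left h hc, mul_zero c⟩

/-- The gain in ISS may be bounded, whereas the integral notion asks for class `𝒦_∞`; adding the
identity enforces unboundedness. -/
theorem ClassK.classKInf_add_id {γ : ℝ → ℝ} (hγ : ClassK γ) : ClassKInf fun r => γ r + r := by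
  refine ⟨⟨hγ.1.add continuousOn_id, fun a ha b hb h => add_lt_add (hγ.2.1 ha hb h) h, by
    simp [hγ.2.2]⟩, ?_⟩
  rintro ⟨c, hc⟩
  have h := hc ⟨|c| + 1, mem_Ici.2 (by positivity), rfl⟩
  have h' := hγ.nonneg (r := |c| + 1) (by positivity)
  have := le_abs_self c
  simp only at h
  linarith

theorem classKL_exp {M l : ℝ} (hM : 0 < M) (hl : 0 < l) :
    ClassKL fun r t => M * Real.exp (-(l * t)) * r := by
  refine ⟨fun t _ => classK_const_mul (by positivity), fun r hr => ⟨by fun_prop, ?_, ?_⟩⟩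
  · intro a _ b _ h
    simp only
    gcongr
  · have h1 : Tendsto (fun t : ℝ => Real.exp (-(l * t))) atTop (𝓝 0) :=
      Real.tendsto_exp_neg_atTop_nhds_zero.comp (tendsto_id.const_mul_atTop hl)
    simpa using (h1.const_mul M).mul_const r

variable {A : X →ₗ.[𝕜] X} {β : 𝕜} {T : ℝ → X →L[𝕜] X} {B : U →L[𝕜] Extrap A β}

/-- The transition map is the sum of the semigroup and of a bounded input-to-state map, which
satisfies the cocycle identity. -/
theorem IsAdmissible.exists_inputMap [CompleteSpace X] [CompleteSpace U] (hT : IsC0Semigroup T)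
    (hA : IsGenerator A T) (hβ : β ∈ resolventSet A) (hB : IsAdmissible ∞ A β T B) :
    ∃ J : ℝ → InputSpace U ∞ →L[𝕜] X,
      (∀ x u t, 0 ≤ t → transitionMap A β T B t x u = T t x + J t u) ∧
      ∀ u h, 0 ≤ h → ∃ v : InputSpace U ∞, ‖v‖ ≤ ‖u‖ ∧
        ∀ t, 0 ≤ t → J (t + h) u = T t (J h u) + J t v := by
  classical
  have hinj := emb_injective hβ
  choose Ψ hΨ using fun t : Ici (0 : ℝ) => hB.exists_clm hT hA hβ t.2
  let J : ℝ → InputSpace U ∞ →L[𝕜] X := fun t => if h : 0 ≤ t then Ψ ⟨t, h⟩ else 0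
  have hJ : ∀ t, 0 ≤ t → ∀ u, emb A β (J t u) = inputIntegral A β T B t u := by
    intro t ht u
    simp only [J, dif_pos ht]
    exact hΨ ⟨t, ht⟩ u
  refine ⟨J, fun x u t ht => ?_, fun u h hh => ?_⟩
  · unfold transitionMap mildSolution
    rw [← hJ t ht, ← emb_add, Function.leftInverse_invFun hinj]
  · obtain ⟨v, hv, hvs⟩ := exists_shift hh u
    refine ⟨v, hv, fun t ht => hinj ?_⟩
    rw [hJ _ (add_nonneg ht hh), inputIntegral_add hT hA hβ B ht hh hvs, emb_add, hJ t ht,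
      ← hJ h hh, extend_emb hT hA hβ ht]

/-- Input-to-state maps of a semigroup with `‖T τ‖ ≤ 1 / 2` are uniformly bounded in time. -/
theorem exists_bound_of_cocycle {V : Type*} [NormedAddCommGroup V] [NormedSpace 𝕜 V]
    [CompleteSpace V] {J : ℝ → V →L[𝕜] X}
    (hJc : ∀ u, ContinuousOn (fun t => J t u) (Ici 0))
    (hJ : ∀ u h, 0 ≤ h → ∃ v : V, ‖v‖ ≤ ‖u‖ ∧
      ∀ t, 0 ≤ t → J (t + h) u = T t (J h u) + J t v)
    {τ : ℝ} (hτ : 0 < τ) (h : ‖T τ‖ ≤ 1 / 2) :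
    ∃ K, 0 < K ∧ ∀ t, 0 ≤ t → ∀ u, ‖J t u‖ ≤ K * ‖u‖ := by
  obtain ⟨K, hK1, hK⟩ := exists_opNorm_le_of_continuousOn hJc τ
  have hK0 : 0 < K := by linarith
  -- The constant `2 * K` is preserved by one step of length `τ`: `1 / 2 * (2 * K) + K = 2 * K`.
  refine ⟨2 * K, by positivity, fun t ht u => ?_⟩
  obtain ⟨n, r, hr, rfl⟩ := exists_nat_mul_add hτ ht
  clear ht
  induction n with
  | zero =>
    have h1 := (J r).le_of_opNorm_le (hK r hr) u
    have h2 : 0 ≤ K * ‖u‖ := by positivity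
    simp only [CharP.cast_eq_zero, zero_mul, zero_add]
    linarith
  | succ n ih =>
    have hr0 := hr.1
    obtain ⟨v, hv, hvJ⟩ := hJ u (n * τ + r) (by positivity)
    have e : ((n + 1 : ℕ) : ℝ) * τ + r = τ + (n * τ + r) := by push_cast; ring
    rw [e, hvJ τ hτ.le]
    have h1 := (T τ).le_of_opNorm_le h (J (n * τ + r) u)
    have h2 := (J τ).le_of_opNorm_le (hK τ ⟨hτ.le, le_rfl⟩) v
    have h3 : K * ‖v‖ ≤ K * ‖u‖ := by gcongr
    refine (norm_add_le _ _).trans ?_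
    linarith

end Equivalence

end LinSys

/-! ### The equivalence -/

theorem mainTheorem11 {𝕜 : Type*} [RCLike 𝕜]
    {X : Type*} [NormedAddCommGroup X] [NormedSpace 𝕜 X] [CompleteSpace X]
    {U : Type*} [NormedAddCommGroup U] [NormedSpace 𝕜 U] [CompleteSpace U]
    (A : X →ₗ.[𝕜] X) (T : ℝ → X →L[𝕜] X)
    (hT : LinSys.IsC0Semigroup T) (hA : LinSys.IsGenerator A T)
    (β : 𝕜) (hβ : β ∈ LinSys.resolventSet A)
    (B : U →L[𝕜] LinSys.Extrap A β)
    (hB : LinSys.IsAdmissible ∞ A β T B)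
    (hcont : ∀ (x₀ : X) (u : LinSys.InputSpace U ∞),
      ContinuousOn (fun t => LinSys.transitionMap A β T B t x₀ u) (Ici 0)) :
    LinSys.IsISS (LinSys.transitionMap A β T B) ↔
      LinSys.IsNormToIntegralISS (LinSys.transitionMap A β T B) := by
  obtain ⟨J, hφ, hJ⟩ := hB.exists_inputMap hT hA hβ
  constructor
  · rintro ⟨b, γ, hb, hγ, h⟩
    have hTb : ∀ x t, 0 ≤ t → ‖T t x‖ ≤ b ‖x‖ t := by
      intro x t ht
      have := h x 0 t ht
      rwa [hφ _ _ _ ht, map_zero, add_zero, norm_zero, hγ.2.2, add_zero] at this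
    have hJγ : ∀ u t, 0 ≤ t → ‖J t u‖ ≤ γ ‖u‖ := by
      intro u t ht
      have := h 0 u t ht
      have hb0 : b 0 t = 0 := (hb.1 t ht).2.2
      rwa [hφ _ _ _ ht, map_zero, zero_add, norm_zero, hb0, zero_add] at this
    obtain ⟨τ, hτ1, hτ⟩ := (((hb.2 1 one_pos).2.2.eventually (gt_mem_nhds one_half_pos)).and
      (eventually_gt_atTop 0)).exists
    have hTτ : ‖T τ‖ ≤ 1 / 2 := by
      have := LinSys.opNorm_le_div_of_closedBall (T τ) (c := 1 / 2) one_pos (by norm_num)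
        fun x hx => (hTb x τ hτ.le).trans (((hb.1 τ hτ.le).mono (norm_nonneg x) hx).trans hτ1.le)
      simpa using this
    obtain ⟨M, l, hM, hl, hexp⟩ := hT.exists_exp_bound hτ hTτ
    have hid : LinSys.ClassK fun r => r := by simpa using LinSys.classK_const_mul one_pos
    -- `M / l` is the integral of `M * exp (-(l * s))` over `[0, ∞)`.
    refine ⟨fun r => r, fun r => M / l * r + r, fun r => γ r + r, hid,
      (LinSys.classK_const_mul (div_pos hM hl)).classKInf_add_id, hγ.classKInf_add_id,
      fun x u t ht => ?_⟩
    have hderiv : ∀ s : ℝ, HasDerivAt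
        (fun s => -(M / l * ‖x‖) * Real.exp (-(l * s)) + s * γ ‖u‖)
        (M * Real.exp (-(l * s)) * ‖x‖ + γ ‖u‖) s := by
      intro s
      have h1 := (((hasDerivAt_id s).const_mul l).neg.exp.const_mul (-(M / l * ‖x‖))).add
        ((hasDerivAt_id s).mul_const (γ ‖u‖))
      refine h1.congr_deriv ?_
      simp only [Pi.neg_apply, id]
      field_simp
    have hcts : Continuous fun s : ℝ => M * Real.exp (-(l * s)) * ‖x‖ + γ ‖u‖ := by fun_prop
    have hint := intervalIntegral.integral_eq_sub_of_hasDerivAt (a := 0) (b := t)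
      (fun s _ => hderiv s) (hcts.intervalIntegrable _ _)
    have hmono := intervalIntegral.integral_mono_on ht
      (hid.intervalIntegrable_comp_norm (hcont x u) le_rfl ht) (hcts.intervalIntegrable 0 t)
      fun s hs => by
        rw [hφ x u s hs.1]
        exact (norm_add_le _ _).trans (add_le_add
          ((T s).le_of_opNorm_le (hexp s hs.1) x) (hJγ u s hs.1))
    rw [hint] at hmono
    refine hmono.trans ?_
    have h1 : 0 ≤ M / l * ‖x‖ * Real.exp (-(l * t)) := by positivity
    have h2 : 0 ≤ t * ‖u‖ := by positivity
    have h3 := norm_nonneg x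
    simp only [mul_zero, neg_zero, Real.exp_zero]
    linarith
  · rintro ⟨α, ψ, σ, hα, hψ, hσ, h⟩
    obtain ⟨τ, hτ, hTτ⟩ := hT.exists_norm_le_half_of_integral_le hα hψ.1 fun x t ht => by
      have h0 := h x 0 t ht
      rw [norm_zero, hσ.1.2.2, mul_zero, add_zero] at h0
      refine (intervalIntegral.integral_congr fun s hs => ?_).trans_le h0
      rw [uIcc_of_le ht] at hs
      simp only [hφ x 0 s hs.1, map_zero, add_zero]
    obtain ⟨M, l, hM, hl, hexp⟩ := hT.exists_exp_bound hτ hTτ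
    -- Strong continuity of `J` is the assumed continuity of the trajectories starting at `0`.
    obtain ⟨K, hK, hJK⟩ := LinSys.exists_bound_of_cocycle (J := J) (fun u =>
      (hcont 0 u).congr fun t ht => by simp [hφ 0 u t ht]) hJ hτ hTτ
    refine ⟨_, _, LinSys.classKL_exp hM hl, LinSys.classK_const_mul hK, fun x u t ht => ?_⟩
    rw [hφ x u t ht]
    exact (norm_add_le _ _).trans (add_le_add
      ((T t).le_of_opNorm_le (hexp t ht) x) (hJK t ht u))
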